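/- Let $(\Omega,\mathcal F,\mathbb P)$ be a probability space with a filtration $\mathbb F=(\mathcal F_t)_{t\ge 0}$. An adapted, (almost surely) continuous process $X=(X_t)_{t\ge0}$ with values in $\mathbb R^d$ is called a $d$-dimensional Brownian motion in $\mathbb F$ if there are a vector $b\in\mathbb R^d$ (the drift) and a symmetric non-negative definite $d\times d$ matrix $A$ (the diffusion matrix) such that for all $0\le s\le t$ the conditional distribution of $X_t-X_s$ given $\mathcal F_s$ is the (possibly degenerate) normal distribution with mean $(t-s)b$ and covariance matrix $(t-s)A$. The initial value $X_0$ is arbitrary. **Theorem.** Let $B$ be an $n$-dimensional Brownian motion in $\mathbb F$ with non-singular diffusion matrix, and let $f:\mathbb R^n\to\mathbb R^m$ be (Borel) measurable. Suppose that the process $f(B)=(f(B_t))_{t\ge0}$ is an $m$-dimensional Brownian motion in the same filtration $\mathbb F$ (with some drift and some diffusion matrix). Then there are an $m\times n$ matrix $P$ and a vector $q\in\mathbb R^m$ such that $$f(x)=Px+q\quad\text{for Lebesgue-almost every }x\in\mathbb R^n,$$ and, almost surely, $f(B_t)=PB_t+q$ for all $t\ge0$ simultaneously. If moreover $n\le 1$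 or $f$ is continuous, then $f(x)=Px+q$ for every $x\in\mathbb R^n$. -/

import Mathlib

open MeasureTheory ProbabilityTheory
open scoped NNReal Matrix

/-- The continuous `n`-dimensional process `B` is a Brownian motion in the filtration `ℱ`, under the
probability measure `μ`, with drift vector `b` and diffusion matrix `A`: it is adapted, its paths
are almost surely continuous, `A` is symmetric and non-negative definite, and for all `s ≤ t` the
conditional distribution of the increment `B t - B s` given `ℱ s` is the (possibly degenerate)
normal distribution with mean `(t - s) b` and covariance matrix `(t - s) A`, that is, the
conditional probability of `B t - B s ∈ S` given `ℱ s` is a.s. the normal measure of `S`, for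
every Borel set `S`. The initial value `B 0` may be any `ℱ 0`-measurable random vector. -/
structure IsBrownianMotionWith {Ω : Type*} {mΩ : MeasurableSpace Ω} {n : ℕ}
    (B : ℝ≥0 → Ω → EuclideanSpace ℝ (Fin n)) (ℱ : Filtration ℝ≥0 mΩ) (μ : Measure Ω)
    (b : EuclideanSpace ℝ (Fin n)) (A : Matrix (Fin n) (Fin n) ℝ) : Prop where
  adapted : Adapted ℱ B
  continuous_paths : ∀ᵐ ω ∂μ, Continuous fun t => B t ω
  posSemidef : A.PosSemidef
  cond_increment : ∀ s t : ℝ≥0, s ≤ t → ∀ S : Set (EuclideanSpace ℝ (Fin n)), MeasurableSet S →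
    μ⟦{ω | B t ω - B s ω ∈ S} | ℱ s⟧ =ᵐ[μ] fun _ =>
      (multivariateGaussian (((t : ℝ) - (s : ℝ)) • b) (((t : ℝ) - (s : ℝ)) • A)).real S

/-- The process `B` is a Brownian motion in the filtration `ℱ` under `μ`, for some drift vector and
some (possibly singular) non-negative definite diffusion matrix. -/
def IsBrownianMotion {Ω : Type*} {mΩ : MeasurableSpace Ω} {n : ℕ}
    (B : ℝ≥0 → Ω → EuclideanSpace ℝ (Fin n)) (ℱ : Filtration ℝ≥0 mΩ) (μ : Measure Ω) : Prop :=
  ∃ (b : EuclideanSpace ℝ (Fin n)) (A : Matrix (Fin n) (Fin n) ℝ), IsBrownianMotionWith B ℱ μ b A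

/-!
# Functions mapping a non-degenerate Brownian motion to a Brownian motion are affine

For a time `h ≥ 0` write the increment of `B` over a time interval of length `h` as
`h b + √h S Z`, with `Z` standard Gaussian and `S` the square root of the diffusion matrix. Since
increments are independent of the past and the law of `B 1` is equivalent to Lebesgue measure, the
hypothesis on `f(B)` says that for almost every starting point `x` the increment
`f (x + h b + √h S Z) - f x` is Gaussian with mean `h c` and covariance matrix `h C`
(`IsBrownianMotionWith.ae_map_comp_increment`). Only the mean and the variance `h V` of each
coordinate are used from here on (`HasIncrementMoments`).

By the Cameron–Martin formula, moving the starting point by `y` amounts to multiplying by a density,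
so `f (x + y) - f x` is the integral of the centred increment `Φ` at `x` against the Cameron–Martin
density `ρ_y` (`HasIncrementMoments.sub_eq_integral`). Consequently the mixed second difference of
`f` is the integral of `Φ` against the second difference of `ρ`. By the Cauchy–Schwarz inequality
its square is at most `h V · Q(1 / h)`, where `Q` is an explicit sum of exponentials with
`Q 0 = Q' 0 = 0`. Letting `h → ∞`, the second differences vanish: this Liouville type argument
replaces any regularity theory for `f`. The first differences are small for small `y` by the same
estimate with `h = 1`, so they define a continuous additive map, and `f` is almost everywhere affine
(`exists_ae_eq_affine`, `exists_ae_eq_affine_of_hasIncrementMoments`).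

The identity passes to the paths by absolute continuity of the law of `B t` for `t > 0`, and
continuity in `t`. In dimension one `B` hits every point with positive probability
(`IsBrownianMotionWith.forall_of_ae_forall`), so there the exceptional null set is empty.
-/

open scoped RealInnerProductSpace

/-! ### The standard Gaussian measure and the Cameron–Martin formula -/

section StandardGaussian

variable {E : Type*} [NormedAddCommGroup E] [InnerProductSpace ℝ E]

/-- The density of the standard Gaussian measure with respect to Lebesgue measure. -/
noncomputable def stdGaussianDensity (z : E) : ℝ :=
  ((2 * Real.pi) ^ (Module.finrank ℝ E / 2 : ℝ))⁻¹ * Real.exp (-(1 / 2) * ‖z‖ ^ 2)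

lemma stdGaussianDensity_pos (z : E) : 0 < stdGaussianDensity z := by
  unfold stdGaussianDensity; positivity

/-- The Cameron–Martin density: the density with respect to the standard Gaussian measure of its
translate by `u`. -/
noncomputable def cameronMartin (u z : E) : ℝ := Real.exp (⟪u, z⟫ - ‖u‖ ^ 2 / 2)

@[simp]
lemma cameronMartin_zero (z : E) : cameronMartin 0 z = 1 := by simp [cameronMartin]

lemma cameronMartin_mul (u v z : E) :
    cameronMartin u z * cameronMartin v z =
      Real.exp (-(‖u‖ ^ 2 / 2 + ‖v‖ ^ 2 / 2)) * Real.exp ⟪u + v, z⟫ := by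
  simp only [cameronMartin, ← Real.exp_add, inner_add_left]
  congr 1; ring

variable [MeasurableSpace E] [BorelSpace E]

@[fun_prop]
lemma measurable_stdGaussianDensity : Measurable (stdGaussianDensity : E → ℝ) := by
  unfold stdGaussianDensity; fun_prop

@[fun_prop]
lemma measurable_cameronMartin (u : E) : Measurable (cameronMartin u) := by
  unfold cameronMartin; fun_prop

variable [FiniteDimensional ℝ E]

lemma integrable_stdGaussianDensity : Integrable (stdGaussianDensity : E → ℝ) := by
  refine Integrable.const_mul ?_ _
  have h := GaussianFourier.integrable_cexp_neg_mul_sq_norm_add (V := E) (b := (1 / 2 : ℂ))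
    (by norm_num) 0 0
  refine h.norm.congr (.of_forall fun z => ?_)
  simp [Complex.norm_exp, ← Complex.ofReal_pow]

/-- The two measures have the same characteristic function. -/
lemma stdGaussian_eq_withDensity :
    stdGaussian E =
      (volume : Measure E).withDensity (fun z => ENNReal.ofReal (stdGaussianDensity z)) := by
  have : IsFiniteMeasure
      ((volume : Measure E).withDensity (fun z => ENNReal.ofReal (stdGaussianDensity z))) :=
    isFiniteMeasure_withDensity_ofReal integrable_stdGaussianDensity.2
  apply Measure.ext_of_charFun
  ext t
  rw [charFun_stdGaussian, charFun_apply]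
  rw [integral_withDensity_eq_integral_toReal_smul (by fun_prop) (by simp)]
  have h := GaussianFourier.integral_cexp_neg_mul_sq_norm_add (V := E) (b := (1 / 2 : ℂ))
    (by norm_num) Complex.I t
  have h2 : ∀ z : E, (ENNReal.ofReal (stdGaussianDensity z)).toReal •
      Complex.exp (⟪z, t⟫ * Complex.I) =
      (((2 * Real.pi) ^ (Module.finrank ℝ E / 2 : ℝ) : ℝ) : ℂ)⁻¹ *
        Complex.exp (-(1 / 2) * ‖z‖ ^ 2 + Complex.I * ⟪t, z⟫) := by
    intro z
    rw [ENNReal.toReal_ofReal (stdGaussianDensity_pos z).le, stdGaussianDensity, Complex.exp_add,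
      real_inner_comm t z]
    simp only [Complex.real_smul]
    push_cast
    ring_nf
  simp_rw [h2]
  rw [integral_const_mul, h]
  have h3 : (((Real.pi : ℝ) : ℂ) / (1 / 2)) ^ (Module.finrank ℝ E / 2 : ℂ) =
      (((2 * Real.pi) ^ (Module.finrank ℝ E / 2 : ℝ) : ℝ) : ℂ) := by
    rw [Complex.ofReal_cpow (by positivity)]
    push_cast
    congr 1
    ring
  rw [h3, ← mul_assoc, inv_mul_cancel₀, one_mul]
  · congr 1
    rw [Complex.I_sq]; ring
  · exact_mod_cast (by positivity : (2 * Real.pi) ^ (Module.finrank ℝ E / 2 : ℝ) ≠ 0)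

lemma volume_absolutelyContinuous_stdGaussian : (volume : Measure E) ≪ stdGaussian E := by
  rw [stdGaussian_eq_withDensity]
  exact withDensity_absolutelyContinuous' (by fun_prop)
    (.of_forall fun z => by simpa using stdGaussianDensity_pos z)

lemma stdGaussian_absolutelyContinuous_volume : stdGaussian E ≪ (volume : Measure E) := by
  rw [stdGaussian_eq_withDensity]
  exact withDensity_absolutelyContinuous _ _

/-- The Cameron–Martin formula. -/
lemma integral_stdGaussian_comp_add_right (F : E → ℝ) (u : E) :
    ∫ z, F (z + u) ∂stdGaussian E = ∫ z, F z * cameronMartin u z ∂stdGaussian E := by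
  rw [stdGaussian_eq_withDensity,
    integral_withDensity_eq_integral_toReal_smul (by fun_prop) (by simp),
    integral_withDensity_eq_integral_toReal_smul (by fun_prop) (by simp),
    ← integral_add_right_eq_self _ u]
  conv_rhs => rw [← integral_add_right_eq_self _ u]
  rw [integral_add_right_eq_self (fun z => (ENNReal.ofReal (stdGaussianDensity z)).toReal •
    F (z + u)) u]
  congr with z
  rw [ENNReal.toReal_ofReal (stdGaussianDensity_pos _).le,
    ENNReal.toReal_ofReal (stdGaussianDensity_pos _).le]
  have : stdGaussianDensity z = stdGaussianDensity (z + u) * cameronMartin u (z + u) := by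
    rw [stdGaussianDensity, stdGaussianDensity, cameronMartin, mul_assoc, ← Real.exp_add,
      norm_add_sq_real, inner_add_right, real_inner_self_eq_norm_sq, real_inner_comm u z]
    congr 2; ring
  rw [this, smul_eq_mul, smul_eq_mul]; ring

lemma map_inner_stdGaussian (u : E) :
    (stdGaussian E).map (fun z => ⟪u, z⟫) = gaussianReal 0 (‖u‖ ^ 2).toNNReal := by
  have := IsGaussian.map_eq_gaussianReal (μ := stdGaussian E) (innerSL ℝ u)
  rw [variance_dual_stdGaussian, integral_strongDual_stdGaussian] at this
  simpa using this

lemma integrable_exp_inner_stdGaussian (u : E) :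
    Integrable (fun z => Real.exp ⟪u, z⟫) (stdGaussian E) := by
  have h := integrable_exp_mul_gaussianReal (μ := 0) (v := (‖u‖ ^ 2).toNNReal) 1
  rw [← map_inner_stdGaussian, integrable_map_measure (by fun_prop) (by fun_prop)] at h
  simpa [Function.comp_def] using h

lemma integral_exp_inner_stdGaussian (u : E) :
    ∫ z, Real.exp ⟪u, z⟫ ∂stdGaussian E = Real.exp (‖u‖ ^ 2 / 2) := by
  have h := mgf_gaussianReal (map_inner_stdGaussian u) 1
  simpa [mgf] using h

lemma integrable_cameronMartin_mul (u v : E) :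
    Integrable (fun z => cameronMartin u z * cameronMartin v z) (stdGaussian E) := by
  simp_rw [cameronMartin_mul]
  exact (integrable_exp_inner_stdGaussian _).const_mul _

lemma integral_cameronMartin_mul (u v : E) :
    ∫ z, cameronMartin u z * cameronMartin v z ∂stdGaussian E = Real.exp ⟪u, v⟫ := by
  simp_rw [cameronMartin_mul]
  rw [integral_const_mul, integral_exp_inner_stdGaussian, ← Real.exp_add, norm_add_sq_real]
  congr 1; ring

lemma memLp_cameronMartin (u : E) : MemLp (cameronMartin u) 2 (stdGaussian E) := by
  rw [memLp_two_iff_integrable_sq (by fun_prop)]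
  simpa [sq] using integrable_cameronMartin_mul u u

lemma integral_cameronMartin (u : E) : ∫ z, cameronMartin u z ∂stdGaussian E = 1 := by
  simpa using integral_cameronMartin_mul u 0

lemma integral_sq_cameronMartin_sub_one (u : E) :
    ∫ z, (cameronMartin u z - 1) ^ 2 ∂stdGaussian E = Real.exp (‖u‖ ^ 2) - 1 := by
  have hu := (memLp_cameronMartin u).integrable one_le_two
  have h : ∀ z, (cameronMartin u z - 1) ^ 2 =
      cameronMartin u z * cameronMartin u z - 2 * cameronMartin u z + 1 := fun z => by ring
  simp_rw [h]
  have huu := integrable_cameronMartin_mul u u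
  rw [integral_add (by fun_prop) (by fun_prop), integral_sub (by fun_prop) (by fun_prop),
    integral_const_mul,
    integral_cameronMartin_mul, integral_cameronMartin, real_inner_self_eq_norm_sq]
  simp; ring

/-- The squared `L²` norm of the mixed second difference of the Cameron–Martin density at `0`. -/
lemma integral_sq_cameronMartin_second_difference (u v : E) :
    ∫ z, (cameronMartin (u + v) z - cameronMartin u z - cameronMartin v z + 1) ^ 2 ∂stdGaussian E =
      Real.exp (‖u + v‖ ^ 2) + Real.exp (‖u‖ ^ 2) + Real.exp (‖v‖ ^ 2) + 2 * Real.exp ⟪u, v⟫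
        - 2 * Real.exp ⟪u + v, u⟫ - 2 * Real.exp ⟪u + v, v⟫ - 1 := by
  have I := fun a b : E => integrable_cameronMartin_mul a b
  have h : ∀ z, (cameronMartin (u + v) z - cameronMartin u z - cameronMartin v z + 1) ^ 2 =
      cameronMartin (u + v) z * cameronMartin (u + v) z + cameronMartin u z * cameronMartin u z
      + cameronMartin v z * cameronMartin v z + 2 * (cameronMartin u z * cameronMartin v z)
      + 2 * (cameronMartin (u + v) z * cameronMartin 0 z)
      + (-2) * (cameronMartin (u + v) z * cameronMartin u z)
      + (-2) * (cameronMartin (u + v) z * cameronMartin v z)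
      + (-2) * (cameronMartin u z * cameronMartin 0 z)
      + (-2) * (cameronMartin v z * cameronMartin 0 z)
      + (cameronMartin 0 z * cameronMartin 0 z) := fun z => by simp; ring
  simp_rw [h]
  repeat rw [integral_add (by fun_prop (disch := assumption)) (by fun_prop (disch := assumption))]
  simp only [integral_const_mul, integral_cameronMartin_mul, real_inner_self_eq_norm_sq,
    inner_zero_right, Real.exp_zero]
  simp; ring

end StandardGaussian

/-- Squared form of the Cauchy–Schwarz inequality for real functions. -/
lemma sq_integral_mul_le {α : Type*} {mα : MeasurableSpace α} {μ : Measure α} {F G : α → ℝ}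
    (hF : MemLp F 2 μ) (hG : MemLp G 2 μ) :
    (∫ z, F z * G z ∂μ) ^ 2 ≤ (∫ z, F z ^ 2 ∂μ) * ∫ z, G z ^ 2 ∂μ := by
  have hFG : Integrable (fun z => F z * G z) μ := hF.integrable_mul hG
  have h : ∀ r : ℝ, 0 ≤ (∫ z, G z ^ 2 ∂μ) * (r * r) + (2 * ∫ z, F z * G z ∂μ) * r
      + ∫ z, F z ^ 2 ∂μ := by
    intro r
    have h0 : 0 ≤ ∫ z, (r * G z + F z) ^ 2 ∂μ := integral_nonneg fun z => sq_nonneg _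
    have h1 : ∀ z, (r * G z + F z) ^ 2 = (r * r) * G z ^ 2 + (2 * r) * (F z * G z) + F z ^ 2 :=
      fun z => by ring
    simp_rw [h1] at h0
    have hG2 := hG.integrable_sq
    have hF2 := hF.integrable_sq
    rw [integral_add (by fun_prop) (by fun_prop), integral_add (by fun_prop) (by fun_prop),
      integral_const_mul, integral_const_mul] at h0
    linarith
  have := discrim_le_zero h
  rw [discrim] at this
  linarith

/-! ### Functions with stationary Gaussian increments are affine -/

section Affine

variable {E : Type*} [NormedAddCommGroup E] [InnerProductSpace ℝ E] [FiniteDimensional ℝ E]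
  [MeasurableSpace E] [BorelSpace E]

/-- A function whose increments `f (x + y) - f x` are, on a conull set, independent of `x` and
small for small `y` is almost everywhere affine. -/
lemma exists_ae_eq_affine {f : E → ℝ} {G : Set E} (hG : ∀ᵐ x : E, x ∈ G)
    (hadd : ∀ x y z, x ∈ G → x + y ∈ G → x + z ∈ G → x + y + z ∈ G →
      f (x + y + z) - f (x + y) - f (x + z) + f x = 0)
    {w : E → ℝ} (hw : Filter.Tendsto w (nhds 0) (nhds 0))
    (hbound : ∀ x y, x ∈ G → x + y ∈ G → |f (x + y) - f x| ≤ w y) :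
    ∃ (L : E →L[ℝ] ℝ) (q : ℝ), ∀ᵐ x : E, f x = L x + q := by
  have htrans : ∀ y : E, ∀ᵐ x : E, x + y ∈ G := fun y =>
    (measurePreserving_add_right volume y).quasiMeasurePreserving.ae hG
  have hbase : ∀ y : E, ∃ x, x ∈ G ∧ x + y ∈ G := fun y => (hG.and (htrans y)).exists
  -- The additive map `g` sends `y` to the increment by `y` at a base point `p y ∈ G ∩ (G - y)`.
  choose p hp hpy using hbase
  have hg : ∀ x y, x ∈ G → x + y ∈ G → f (x + y) - f x = f (p y + y) - f (p y) := by
    intro x y hx hxy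
    have h := hadd x y (p y - x) hx hxy (by simpa using hp y)
      (by convert hpy y using 1; abel)
    rw [show x + y + (p y - x) = p y + y by abel, show x + (p y - x) = p y by abel] at h
    linarith
  let g : E →+ ℝ :=
    { toFun := fun y => f (p y + y) - f (p y)
      map_zero' := by simp
      map_add' := by
        intro y z
        obtain ⟨x, hx, hxy, hxyz⟩ := (hG.and ((htrans y).and (htrans (y + z)))).exists
        rw [← add_assoc] at hxyz
        rw [← hg x (y + z) hx (by rwa [← add_assoc]), ← hg x y hx hxy,
          ← hg (x + y) z hxy hxyz, ← add_assoc]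
        ring }
  have hgc : Continuous g := by
    refine continuous_of_continuousAt_zero g ?_
    rw [ContinuousAt, map_zero]
    exact squeeze_zero_norm (fun y => hbound _ _ (hp y) (hpy y)) hw
  obtain ⟨x₀, hx₀⟩ := hG.exists
  refine ⟨g.toRealLinearMap hgc, f x₀ - g x₀, ?_⟩
  filter_upwards [hG] with x hx
  have h := hg x₀ (x - x₀) hx₀ (by simpa using hx)
  have h2 : g (x - x₀) = g x - g x₀ := map_sub g x x₀
  have h3 : g (x - x₀) = f (p (x - x₀) + (x - x₀)) - f (p (x - x₀)) := rfl
  rw [add_sub_cancel] at h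
  change f x = g x + _
  linarith

/-- The property that, for `Z` standard Gaussian, the increment `f (x + h b + √h S Z) - f x` of `f`
at `x` along the Gaussian vector `h b + √h S Z` is square integrable with mean `h c` and variance
`h V`. Mean and variance are stated through the centred increment. -/
def HasIncrementMoments (f : E → ℝ) (b : E) (S : E ≃L[ℝ] E) (c V h : ℝ) (x : E) : Prop :=
  MemLp (fun z => f (x + (h • b + √h • S z)) - f x - h * c) 2 (stdGaussian E) ∧
  ∫ z, (f (x + (h • b + √h • S z)) - f x - h * c) ∂stdGaussian E = 0 ∧
  ∫ z, (f (x + (h • b + √h • S z)) - f x - h * c) ^ 2 ∂stdGaussian E = h * V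

/-- A translation by `y` is absorbed into the Gaussian vector, at the price of a Cameron–Martin
density. This expresses increments at `x` through the centred Gaussian increment at `x` alone. -/
lemma HasIncrementMoments.sub_eq_integral {f : E → ℝ} {b : E} {S : E ≃L[ℝ] E} {c V h : ℝ} {x y : E}
    (hh : 0 < h) (hxy : HasIncrementMoments f b S c V h (x + y)) :
    f (x + y) - f x = ∫ z, (f (x + (h • b + √h • S z)) - f x - h * c) *
      cameronMartin ((√h)⁻¹ • S.symm y) z ∂stdGaussian E := by
  rw [← integral_stdGaussian_comp_add_right
    (fun z => f (x + (h • b + √h • S z)) - f x - h * c)]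
  have h0 : √h ≠ 0 := (Real.sqrt_pos.2 hh).ne'
  have key : ∀ z, f (x + (h • b + √h • S (z + (√h)⁻¹ • S.symm y))) - f x - h * c =
      (f (x + y + (h • b + √h • S z)) - f (x + y) - h * c) + (f (x + y) - f x) := by
    intro z
    have : x + (h • b + √h • S (z + (√h)⁻¹ • S.symm y)) = x + y + (h • b + √h • S z) := by
      rw [map_add, map_smul, smul_add, smul_smul, mul_inv_cancel₀ h0, one_smul,
        ContinuousLinearEquiv.apply_symm_apply]
      abel
    rw [this]; ring
  simp_rw [key]
  rw [integral_add (hxy.1.integrable one_le_two) (integrable_const _), hxy.2.1]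
  simp

lemma integral_mul_cameronMartin_sub_one {F : E → ℝ} (hF : MemLp F 2 (stdGaussian E))
    (h0 : ∫ z, F z ∂stdGaussian E = 0) (u : E) :
    ∫ z, F z * (cameronMartin u z - 1) ∂stdGaussian E =
      ∫ z, F z * cameronMartin u z ∂stdGaussian E := by
  have i0 := hF.integrable one_le_two
  have i1 : Integrable (fun z => F z * cameronMartin u z) (stdGaussian E) :=
    hF.integrable_mul (memLp_cameronMartin u)
  simp_rw [mul_sub, mul_one]
  rw [integral_sub i1 i0, h0, sub_zero]

lemma integral_mul_cameronMartin_second_difference {F : E → ℝ} (hF : MemLp F 2 (stdGaussian E))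
    (h0 : ∫ z, F z ∂stdGaussian E = 0) (u v : E) :
    ∫ z, F z * (cameronMartin (u + v) z - cameronMartin u z - cameronMartin v z + 1)
        ∂stdGaussian E =
      ∫ z, F z * cameronMartin (u + v) z ∂stdGaussian E
        - ∫ z, F z * cameronMartin u z ∂stdGaussian E
        - ∫ z, F z * cameronMartin v z ∂stdGaussian E := by
  have i0 := hF.integrable one_le_two
  have i : ∀ a, Integrable (fun z => F z * cameronMartin a z) (stdGaussian E) := fun a =>
    hF.integrable_mul (memLp_cameronMartin a)
  simp_rw [mul_add, mul_sub, mul_one]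
  rw [integral_add (by fun_prop) i0, integral_sub (by fun_prop) (i _), integral_sub (i _) (i _),
    h0, add_zero]

lemma HasIncrementMoments.sq_sub_le {f : E → ℝ} {b : E} {S : E ≃L[ℝ] E} {c V h : ℝ} {x y : E}
    (hh : 0 < h) (hx : HasIncrementMoments f b S c V h x)
    (hxy : HasIncrementMoments f b S c V h (x + y)) :
    (f (x + y) - f x) ^ 2 ≤ h * V * (Real.exp (‖(√h)⁻¹ • S.symm y‖ ^ 2) - 1) := by
  have hCS := sq_integral_mul_le hx.1
    ((memLp_cameronMartin ((√h)⁻¹ • S.symm y)).sub (memLp_const 1))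
  simp only [Pi.sub_apply] at hCS
  rw [hx.2.2, integral_sq_cameronMartin_sub_one] at hCS
  convert hCS using 2
  rw [hxy.sub_eq_integral hh, integral_mul_cameronMartin_sub_one hx.1 hx.2.1]

lemma HasIncrementMoments.sq_second_difference_le {f : E → ℝ} {b : E} {S : E ≃L[ℝ] E}
    {c V h : ℝ} {x y z : E} (hh : 0 < h) (hx : HasIncrementMoments f b S c V h x)
    (hxy : HasIncrementMoments f b S c V h (x + y))
    (hxz : HasIncrementMoments f b S c V h (x + z))
    (hxyz : HasIncrementMoments f b S c V h (x + y + z)) {u v : E}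
    (hu : u = (√h)⁻¹ • S.symm y) (hv : v = (√h)⁻¹ • S.symm z) :
    (f (x + y + z) - f (x + y) - f (x + z) + f x) ^ 2 ≤ h * V *
      (Real.exp (‖u + v‖ ^ 2) + Real.exp (‖u‖ ^ 2) + Real.exp (‖v‖ ^ 2) + 2 * Real.exp ⟪u, v⟫
        - 2 * Real.exp ⟪u + v, u⟫ - 2 * Real.exp ⟪u + v, v⟫ - 1) := by
  have hCS := sq_integral_mul_le hx.1 ((((memLp_cameronMartin (u + v)).sub
    (memLp_cameronMartin u)).sub (memLp_cameronMartin v)).add (memLp_const 1))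
  simp only [Pi.sub_apply, Pi.add_apply] at hCS
  rw [hx.2.2, integral_sq_cameronMartin_second_difference] at hCS
  convert hCS using 2
  have e1 := hxy.sub_eq_integral hh
  have e2 := hxz.sub_eq_integral hh
  rw [add_assoc] at hxyz
  have e3 := hxyz.sub_eq_integral hh
  rw [← hu] at e1
  rw [← hv] at e2
  rw [map_add, smul_add, ← hu, ← hv] at e3
  rw [integral_mul_cameronMartin_second_difference hx.1 hx.2.1, ← e1, ← e2, ← e3, ← add_assoc]
  ring

/-- If the mean and the variance of the Gaussian increments of `f` are the same at almost every
point and grow linearly in time, for all integer times, then `f` is almost everywhere affine. The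
point is that the variance of the increment grows like `h`, while the squared norm of the second
difference of the Gaussian density decays like `h⁻²`. -/
lemma exists_ae_eq_affine_of_hasIncrementMoments {f : E → ℝ} {b : E} {S : E ≃L[ℝ] E} {c V : ℝ}
    (hf : ∀ᵐ x : E, ∀ k : ℕ, HasIncrementMoments f b S c V (k + 1) x) :
    ∃ (L : E →L[ℝ] ℝ) (q : ℝ), ∀ᵐ x : E, f x = L x + q := by
  refine exists_ae_eq_affine (G := {x | ∀ k : ℕ, HasIncrementMoments f b S c V (k + 1) x})
    hf ?_ (w := fun y => √(V * (Real.exp (‖S.symm y‖ ^ 2) - 1))) ?_ ?_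
  · intro x y z hx hxy hxz hxyz
    -- The second difference at time `h` has square at most `h * V * Q h⁻¹`.
    set p := S.symm y
    set q := S.symm z
    let Q : ℝ → ℝ := fun τ => Real.exp (τ * ‖p + q‖ ^ 2) + Real.exp (τ * ‖p‖ ^ 2)
      + Real.exp (τ * ‖q‖ ^ 2) + 2 * Real.exp (τ * ⟪p, q⟫) - 2 * Real.exp (τ * ⟪p + q, p⟫)
      - 2 * Real.exp (τ * ⟪p + q, q⟫) - 1
    have hQ0 : Q 0 = 0 := by simp [Q]; norm_num
    have hQ' : HasDerivAt Q 0 0 := by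
      have he : ∀ a : ℝ, HasDerivAt (fun τ : ℝ => Real.exp (τ * a)) a 0 := by
        intro a
        simpa using ((hasDerivAt_id (0 : ℝ)).mul_const a).exp
      have h := ((((((he (‖p + q‖ ^ 2)).add (he (‖p‖ ^ 2))).add (he (‖q‖ ^ 2))).add
        ((he ⟪p, q⟫).const_mul 2)).sub ((he ⟪p + q, p⟫).const_mul 2)).sub
        ((he ⟪p + q, q⟫).const_mul 2)).sub_const 1
      refine HasDerivAt.congr_deriv (show HasDerivAt Q _ 0 from h) ?_
      rw [norm_add_sq_real, inner_add_left, inner_add_left, real_inner_self_eq_norm_sq,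
        real_inner_self_eq_norm_sq, real_inner_comm p q]
      ring
    have hlim : Filter.Tendsto (fun k : ℕ => ((k : ℝ) + 1) * V * Q ((k : ℝ) + 1)⁻¹)
        Filter.atTop (nhds 0) := by
      have hs : Filter.Tendsto (fun k : ℕ => ((k : ℝ) + 1)⁻¹) Filter.atTop
          (nhdsWithin 0 {0}ᶜ) := by
        refine tendsto_nhdsWithin_iff.2 ⟨?_, .of_forall fun k => ?_⟩
        · simpa using tendsto_one_div_add_atTop_nhds_zero_nat (𝕜 := ℝ)
        · exact (inv_pos.2 (by positivity)).ne'
      have h := ((hasDerivAt_iff_tendsto_slope.1 hQ').comp hs).const_mul V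
      rw [mul_zero] at h
      refine h.congr fun k => ?_
      simp only [Function.comp_apply, slope_def_field, hQ0, sub_zero, div_inv_eq_mul]
      ring
    have hle : ∀ k : ℕ, (f (x + y + z) - f (x + y) - f (x + z) + f x) ^ 2 ≤
        ((k : ℝ) + 1) * V * Q ((k : ℝ) + 1)⁻¹ := by
      intro k
      have hk : (0 : ℝ) < k + 1 := by positivity
      have h := (hx k).sq_second_difference_le hk (hxy k) (hxz k) (hxyz k) rfl rfl
      have hr : (√((k : ℝ) + 1))⁻¹ * (√((k : ℝ) + 1))⁻¹ = ((k : ℝ) + 1)⁻¹ := by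
        rw [← mul_inv, Real.mul_self_sqrt hk.le]
      simp only [← smul_add, norm_smul, mul_pow, Real.norm_eq_abs, sq_abs, real_inner_smul_left,
        real_inner_smul_right, ← mul_assoc, hr, sq (√((k : ℝ) + 1))⁻¹] at h
      exact h
    exact pow_eq_zero_iff (two_ne_zero) |>.1 (le_antisymm
      (ge_of_tendsto' hlim hle) (sq_nonneg _))
  · have : Continuous fun y : E => √(V * (Real.exp (‖S.symm y‖ ^ 2) - 1)) := by fun_prop
    simpa using this.tendsto 0
  · -- The choice `h = 1` already controls the first differences.
    intro x y hx hxy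
    refine Real.abs_le_sqrt ?_
    have hx0 := hx 0
    have hxy0 := hxy 0
    simp only [Nat.cast_zero, zero_add] at hx0 hxy0
    simpa using hx0.sq_sub_le one_pos hxy0

end Affine

/-! ### Non-degenerate multivariate Gaussian measures -/

section MultivariateGaussian

variable {E : Type*} [NormedAddCommGroup E] [InnerProductSpace ℝ E] [FiniteDimensional ℝ E]
  [MeasurableSpace E] [BorelSpace E]

lemma map_stdGaussian_absolutelyContinuous_volume (a : E) (S : E ≃L[ℝ] E) :
    (stdGaussian E).map (fun z => a + S z) ≪ (volume : Measure E) := by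
  refine (stdGaussian_absolutelyContinuous_volume.map (by fun_prop)).trans ?_
  have h1 := Measure.LinearMap.quasiMeasurePreserving (volume : Measure E)
    (S : E →ₗ[ℝ] E) (LinearEquiv.isUnit_det' S.toLinearEquiv).ne_zero
  exact ((measurePreserving_add_left volume a).quasiMeasurePreserving.comp h1).absolutelyContinuous

lemma volume_absolutelyContinuous_map_stdGaussian (a : E) (S : E ≃L[ℝ] E) :
    (volume : Measure E) ≪ (stdGaussian E).map (fun z => a + S z) := by
  have h1 := Measure.LinearMap.quasiMeasurePreserving (volume : Measure E)
    (S.symm : E →ₗ[ℝ] E) (LinearEquiv.isUnit_det' S.symm.toLinearEquiv).ne_zero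
  have h2 := h1.comp (measurePreserving_add_left volume (-a)).quasiMeasurePreserving
  have h3 := (h2.absolutelyContinuous.trans volume_absolutelyContinuous_stdGaussian).map
    (f := fun z => a + S z) (by fun_prop)
  rw [Measure.map_map (by fun_prop) h2.measurable] at h3
  have : (fun z => a + S z) ∘ (⇑(S.symm : E →ₗ[ℝ] E) ∘ fun z => -a + z) = id := by
    ext z; simp
  rwa [this, Measure.map_id] at h3

open scoped MatrixOrder in
/-- The linear isomorphism is multiplication by the square root of the covariance matrix. -/
lemma exists_multivariateGaussian_eq_map {n : ℕ} {A : Matrix (Fin n) (Fin n) ℝ}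
    (hA : A.PosSemidef) (hdet : A.det ≠ 0) :
    ∃ S : EuclideanSpace ℝ (Fin n) ≃L[ℝ] EuclideanSpace ℝ (Fin n),
      ∀ (b : EuclideanSpace ℝ (Fin n)) (h : ℝ), 0 ≤ h → multivariateGaussian (h • b) (h • A) =
        (stdGaussian (EuclideanSpace ℝ (Fin n))).map (fun z => h • b + √h • S z) := by
  have hsq : CFC.sqrt A * CFC.sqrt A = A := CFC.sqrt_mul_sqrt_self _ hA.nonneg
  have hu : IsUnit (CFC.sqrt A).det := by
    refine isUnit_iff_ne_zero.2 fun h0 => hdet ?_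
    rw [← hsq, Matrix.det_mul, h0, zero_mul]
  let T := Matrix.toEuclideanCLM (n := Fin n) (𝕜 := ℝ)
  refine ⟨ContinuousLinearEquiv.equivOfInverse (T (CFC.sqrt A)) (T (CFC.sqrt A)⁻¹) ?_ ?_, ?_⟩
  · intro z
    rw [← ContinuousLinearMap.comp_apply, ← ContinuousLinearMap.mul_def, ← map_mul,
      Matrix.nonsing_inv_mul _ hu, map_one]
    rfl
  · intro z
    rw [← ContinuousLinearMap.comp_apply, ← ContinuousLinearMap.mul_def, ← map_mul,
      Matrix.mul_nonsing_inv _ hu, map_one]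
    rfl
  · intro b h hh
    have hs : CFC.sqrt (h • A) = √h • CFC.sqrt A := by
      refine CFC.sqrt_unique ?_ ?_
      · rw [smul_mul_smul_comm, Real.mul_self_sqrt hh, hsq]
      · exact smul_nonneg (Real.sqrt_nonneg h) (CFC.sqrt_nonneg A)
    rw [multivariateGaussian, hs]
    congr with z
    simp [T]

lemma Matrix.det_smul_ne_zero {n : ℕ} {A : Matrix (Fin n) (Fin n) ℝ} (hA : A.det ≠ 0) {t : ℝ}
    (ht : t ≠ 0) : (t • A).det ≠ 0 := by
  rw [Matrix.det_smul]; positivity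

lemma multivariateGaussian_absolutelyContinuous_volume {n : ℕ} {A : Matrix (Fin n) (Fin n) ℝ}
    (hA : A.PosSemidef) (hdet : A.det ≠ 0) (b : EuclideanSpace ℝ (Fin n)) :
    multivariateGaussian b A ≪ volume := by
  obtain ⟨S, hS⟩ := exists_multivariateGaussian_eq_map hA hdet
  have h := hS b 1 zero_le_one
  simp only [one_smul, Real.sqrt_one] at h
  exact h ▸ map_stdGaussian_absolutelyContinuous_volume b S

lemma volume_absolutelyContinuous_multivariateGaussian {n : ℕ} {A : Matrix (Fin n) (Fin n) ℝ}
    (hA : A.PosSemidef) (hdet : A.det ≠ 0) (b : EuclideanSpace ℝ (Fin n)) :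
    volume ≪ multivariateGaussian b A := by
  obtain ⟨S, hS⟩ := exists_multivariateGaussian_eq_map hA hdet
  have h := hS b 1 zero_le_one
  simp only [one_smul, Real.sqrt_one] at h
  exact h ▸ volume_absolutelyContinuous_map_stdGaussian b S

/-- If the increment of `f` at `x` is Gaussian with mean `h c` and covariance matrix `h C`, then the
coordinates of `f` have the corresponding increment moments. -/
lemma hasIncrementMoments_of_map_eq {n m : ℕ}
    {f : EuclideanSpace ℝ (Fin n) → EuclideanSpace ℝ (Fin m)} (hf : Measurable f)
    {b : EuclideanSpace ℝ (Fin n)} {S : EuclideanSpace ℝ (Fin n) ≃L[ℝ] EuclideanSpace ℝ (Fin n)}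
    {c : EuclideanSpace ℝ (Fin m)} {C : Matrix (Fin m) (Fin m) ℝ} (hC : C.PosSemidef)
    {h : ℝ} (hh : 0 ≤ h) {x : EuclideanSpace ℝ (Fin n)}
    (hx : ((stdGaussian (EuclideanSpace ℝ (Fin n))).map (fun z => h • b + √h • S z)).map
      (fun w => f (x + w) - f x) = multivariateGaussian (h • c) (h • C)) (j : Fin m) :
    HasIncrementMoments (fun y => f y j) b S (c j) (C j j) h x := by
  have hCj : 0 ≤ C j j := hC.diag_nonneg
  have hlaw : (stdGaussian (EuclideanSpace ℝ (Fin n))).map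
      (fun z => f (x + (h • b + √h • S z)) j - f x j) =
      gaussianReal (h * c j) (h * C j j).toNNReal := by
    have h1 := (measurePreserving_eval_multivariateGaussian (μ := h • c)
      (hC.smul hh) (i := j)).map_eq
    rw [← hx, Measure.map_map (by fun_prop) (by fun_prop),
      Measure.map_map (by fun_prop) (by fun_prop)] at h1
    simpa [Function.comp_def] using h1
  have hlaw0 : (stdGaussian (EuclideanSpace ℝ (Fin n))).map
      (fun z => f (x + (h • b + √h • S z)) j - f x j - h * c j) =
      gaussianReal 0 (h * C j j).toNNReal := by
    have h1 := congrArg (fun ρ => ρ.map (fun r : ℝ => r - h * c j)) hlaw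
    simp only [gaussianReal_map_sub_const, sub_self] at h1
    rwa [Measure.map_map (by fun_prop) (by fun_prop)] at h1
  have hmeas : Measurable (fun z => f (x + (h • b + √h • S z)) j - f x j - h * c j) := by
    fun_prop
  refine ⟨?_, ?_, ?_⟩
  · have h1 := memLp_id_gaussianReal (μ := 0) (v := (h * C j j).toNNReal) 2
    rw [← hlaw0, memLp_map_measure_iff (by fun_prop) hmeas.aemeasurable] at h1
    exact h1
  · have h1 := integral_id_gaussianReal (μ := 0) (v := (h * C j j).toNNReal)
    rw [← hlaw0, integral_map hmeas.aemeasurable (by fun_prop)] at h1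
    exact h1
  · have h1 := variance_id_gaussianReal (μ := 0) (v := (h * C j j).toNNReal)
    rw [variance_of_integral_eq_zero aemeasurable_id (by simp), ← hlaw0,
      integral_map hmeas.aemeasurable (by fun_prop), Real.coe_toNNReal _ (by positivity)] at h1
    exact h1

end MultivariateGaussian

/-! ### Constant conditional laws and independence -/

section ConditionalLaw

variable {Ω E F : Type*} [MeasurableSpace E] [MeasurableSpace F] {m mΩ : MeasurableSpace Ω}

/-- If the conditional law of `D` given `m` is the constant `γ`, then `D` has law `γ` and is
independent of every `m`-measurable `X`. -/
lemma map_prodMk_eq_prod_of_condExp (hm : m ≤ mΩ) {μ : Measure Ω} [IsProbabilityMeasure μ]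
    {X : Ω → E} (hX : Measurable[m] X) {D : Ω → F} (hD : Measurable D)
    {γ : Measure F} [IsProbabilityMeasure γ]
    (h : ∀ S, MeasurableSet S → μ⟦{ω | D ω ∈ S} | m⟧ =ᵐ[μ] fun _ => γ.real S) :
    μ.map (fun ω => (X ω, D ω)) = (μ.map X).prod γ := by
  have hX' : Measurable X := hX.mono hm le_rfl
  have : IsProbabilityMeasure (μ.map X) := Measure.isProbabilityMeasure_map hX'.aemeasurable
  refine (Measure.prod_eq fun s t hs ht => ?_).symm
  rw [Measure.map_apply (hX'.prodMk hD) (hs.prod ht), Measure.map_apply hX' hs]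
  have hDt : MeasurableSet {ω | D ω ∈ t} := hD ht
  have h1 := setIntegral_condExp hm (μ := μ) (f := {ω | D ω ∈ t}.indicator fun _ => (1 : ℝ))
    ((integrable_const _).indicator hDt) (hX hs)
  rw [setIntegral_congr_ae (hX' hs) ((h t ht).mono fun x hx _ => hx), setIntegral_const,
    setIntegral_indicator hDt, setIntegral_const] at h1
  simp only [smul_eq_mul, mul_one] at h1
  rw [← ENNReal.toReal_eq_toReal_iff' (by finiteness) (by finiteness), ENNReal.toReal_mul]
  exact h1.symm

/-- If `X` is independent of `D`, and `Ψ X D` is independent of `X` too, then for almost every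
value `x` of `X` the law of `Ψ x D` is that of `Ψ X D`. -/
lemma ae_map_eq_of_map_prod_eq {F' : Type*} [MeasurableSpace F']
    [MeasurableSpace.CountableOrCountablyGenerated E F']
    {ν : Measure E} {γ : Measure F} {N : Measure F'} [IsProbabilityMeasure ν]
    [IsProbabilityMeasure γ] [IsProbabilityMeasure N] {Ψ : E → F → F'}
    (hΨ : Measurable (Function.uncurry Ψ))
    (h : (ν.prod γ).map (fun p => (p.1, Ψ p.1 p.2)) = ν.prod N) :
    ∀ᵐ x ∂ν, γ.map (Ψ x) = N := by
  have hΨ' : Measurable fun p : E × F => (p.1, Ψ p.1 p.2) := measurable_fst.prodMk hΨ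
  let κ : Kernel E F' := (Kernel.id ×ₖ Kernel.const E γ).map (Function.uncurry Ψ)
  have hκ : ∀ x, κ x = γ.map (Ψ x) := by
    intro x
    rw [Kernel.map_apply _ hΨ, Kernel.prod_apply, Kernel.id_apply, Kernel.const_apply,
      Measure.dirac_prod, Measure.map_map hΨ (by fun_prop)]
    rfl
  have : IsMarkovKernel κ := Kernel.IsMarkovKernel.map _ hΨ
  have key : ν ⊗ₘ κ = ν ⊗ₘ Kernel.const E N := by
    rw [Measure.compProd_const, ← h]
    ext s hs
    rw [Measure.compProd_apply hs, Measure.map_apply hΨ' hs, Measure.prod_apply (hΨ' hs)]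
    congr with x
    rw [hκ, Measure.map_apply (f := Ψ x) (hΨ.comp measurable_prodMk_left)
      (measurable_prodMk_left hs)]
    rfl
  filter_upwards [Kernel.ae_eq_of_compProd_eq key] with x hx
  rw [← hκ, hx, Kernel.const_apply]

end ConditionalLaw

/-! ### Increments and marginal laws of Brownian motion -/

namespace IsBrownianMotionWith

variable {Ω : Type*} {mΩ : MeasurableSpace Ω} {μ : Measure Ω} {ℱ : Filtration ℝ≥0 mΩ} {n : ℕ}
  {B : ℝ≥0 → Ω → EuclideanSpace ℝ (Fin n)} {b : EuclideanSpace ℝ (Fin n)}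
  {A : Matrix (Fin n) (Fin n) ℝ}

lemma measurable (hB : IsBrownianMotionWith B ℱ μ b A) (t : ℝ≥0) : Measurable (B t) :=
  (hB.adapted t).mono (ℱ.le t) le_rfl

lemma measurable_prodMk_increment (hB : IsBrownianMotionWith B ℱ μ b A) (s t : ℝ≥0) :
    Measurable fun ω => (B s ω, B t ω - B s ω) :=
  (hB.measurable s).prodMk ((hB.measurable t).sub (hB.measurable s))

/-- The increment `B t - B s` is Gaussian and independent of `ℱ s`. -/
lemma map_prodMk_increment [IsProbabilityMeasure μ] (hB : IsBrownianMotionWith B ℱ μ b A)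
    {E : Type*} [MeasurableSpace E] {s t : ℝ≥0} (hst : s ≤ t) {X : Ω → E}
    (hX : Measurable[ℱ s] X) :
    μ.map (fun ω => (X ω, B t ω - B s ω)) = (μ.map X).prod
      (multivariateGaussian (((t : ℝ) - (s : ℝ)) • b) (((t : ℝ) - (s : ℝ)) • A)) :=
  map_prodMk_eq_prod_of_condExp (ℱ.le s) hX ((hB.measurable t).sub (hB.measurable s))
    (hB.cond_increment s t hst)

lemma map_eq_map_add [IsProbabilityMeasure μ] (hB : IsBrownianMotionWith B ℱ μ b A) (t : ℝ≥0) :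
    μ.map (B t) = ((μ.map (B 0)).prod (multivariateGaussian ((t : ℝ) • b) ((t : ℝ) • A))).map
      (fun p => p.1 + p.2) := by
  have h := hB.map_prodMk_increment (zero_le : 0 ≤ t) (hB.adapted 0)
  rw [NNReal.coe_zero, sub_zero] at h
  rw [← h, Measure.map_map (by fun_prop)
    (hB.measurable_prodMk_increment 0 t)]
  congr with ω
  simp

lemma map_absolutelyContinuous_volume [IsProbabilityMeasure μ]
    (hB : IsBrownianMotionWith B ℱ μ b A) (hA : A.det ≠ 0) {t : ℝ≥0} (ht : 0 < t) :
    μ.map (B t) ≪ volume := by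
  rw [hB.map_eq_map_add t]
  refine Measure.AbsolutelyContinuous.mk fun s hs h0 => ?_
  rw [Measure.map_apply (by fun_prop) hs, Measure.prod_apply ((by fun_prop : Measurable
    fun p : EuclideanSpace ℝ (Fin n) × EuclideanSpace ℝ (Fin n) => p.1 + p.2) hs)]
  refine lintegral_eq_zero_of_ae_eq_zero (.of_forall fun x => ?_)
  refine multivariateGaussian_absolutelyContinuous_volume (hB.posSemidef.smul t.coe_nonneg)
    (Matrix.det_smul_ne_zero hA (by exact_mod_cast ht.ne')) _ ?_
  exact (measure_preimage_add volume x s).trans h0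

lemma volume_absolutelyContinuous_map [IsProbabilityMeasure μ]
    (hB : IsBrownianMotionWith B ℱ μ b A) (hA : A.det ≠ 0) {t : ℝ≥0} (ht : 0 < t) :
    volume ≪ μ.map (B t) := by
  have : IsProbabilityMeasure (μ.map (B 0)) :=
    Measure.isProbabilityMeasure_map (hB.measurable 0).aemeasurable
  rw [hB.map_eq_map_add t]
  refine Measure.AbsolutelyContinuous.mk fun s hs h0 => ?_
  have hm := (by fun_prop : Measurable
    fun p : EuclideanSpace ℝ (Fin n) × EuclideanSpace ℝ (Fin n) => p.1 + p.2) hs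
  rw [Measure.map_apply (by fun_prop) hs, Measure.measure_prod_null hm] at h0
  obtain ⟨x, hx⟩ := h0.exists
  have h1 := volume_absolutelyContinuous_multivariateGaussian (hB.posSemidef.smul t.coe_nonneg)
    (Matrix.det_smul_ne_zero hA (by exact_mod_cast ht.ne')) ((t : ℝ) • b) hx
  exact (measure_preimage_add volume x s).symm.trans h1

/-- The Brownian property of `f(B)`, read off at a deterministic starting point. -/
lemma ae_map_comp_increment [IsProbabilityMeasure μ] (hB : IsBrownianMotionWith B ℱ μ b A)
    (hA : A.det ≠ 0) {m : ℕ} {f : EuclideanSpace ℝ (Fin n) → EuclideanSpace ℝ (Fin m)}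
    (hf : Measurable f) {c : EuclideanSpace ℝ (Fin m)} {C : Matrix (Fin m) (Fin m) ℝ}
    (hfB : IsBrownianMotionWith (fun t ω => f (B t ω)) ℱ μ c C) (h : ℝ≥0) :
    ∀ᵐ x, (multivariateGaussian ((h : ℝ) • b) ((h : ℝ) • A)).map (fun w => f (x + w) - f x) =
      multivariateGaussian ((h : ℝ) • c) ((h : ℝ) • C) := by
  have : IsProbabilityMeasure (μ.map (B 1)) :=
    Measure.isProbabilityMeasure_map (hB.measurable 1).aemeasurable
  -- Over the time interval `[1, 1 + h]`: at time `1` the law of `B` has full support.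
  refine (hB.volume_absolutelyContinuous_map hA one_pos).ae_le ?_
  have h1 := hB.map_prodMk_increment (le_self_add : 1 ≤ 1 + h) (hB.adapted 1)
  have h2 := hfB.map_prodMk_increment (le_self_add : 1 ≤ 1 + h) (hB.adapted 1)
  rw [NNReal.coe_add, add_sub_cancel_left] at h1 h2
  refine ae_map_eq_of_map_prod_eq (Ψ := fun x w => f (x + w) - f x) (by fun_prop) ?_
  rw [← h1, ← h2, Measure.map_map (by fun_prop)
    (hB.measurable_prodMk_increment 1 (1 + h))]
  congr with ω
  · simp
  · simp

end IsBrownianMotionWith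

/-! ### Affine functions of Brownian motion -/

lemma exists_ae_eq_mulVec_add {n m : ℕ}
    {f : EuclideanSpace ℝ (Fin n) → EuclideanSpace ℝ (Fin m)}
    (h : ∀ j, ∃ (L : EuclideanSpace ℝ (Fin n) →L[ℝ] ℝ) (q : ℝ), ∀ᵐ x, f x j = L x + q) :
    ∃ (P : Matrix (Fin m) (Fin n) ℝ) (q : EuclideanSpace ℝ (Fin m)),
      ∀ᵐ x, f x = WithLp.toLp 2 (P *ᵥ x.ofLp) + q := by
  choose L q hLq using h
  refine ⟨Matrix.of fun j i => L j (EuclideanSpace.basisFun (Fin n) ℝ i), WithLp.toLp 2 q, ?_⟩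
  filter_upwards [ae_all_iff.2 hLq] with x hx
  ext j
  rw [hx j]
  nth_rw 1 [← (EuclideanSpace.basisFun (Fin n) ℝ).sum_repr x]
  simp [Matrix.mulVec, dotProduct, mul_comm]

namespace IsBrownianMotionWith

variable {Ω : Type*} {mΩ : MeasurableSpace Ω} {μ : Measure Ω} {ℱ : Filtration ℝ≥0 mΩ} {n : ℕ}
  {B : ℝ≥0 → Ω → EuclideanSpace ℝ (Fin n)} {b : EuclideanSpace ℝ (Fin n)}
  {A : Matrix (Fin n) (Fin n) ℝ}

lemma exists_ae_eq_mulVec_add [IsProbabilityMeasure μ] (hB : IsBrownianMotionWith B ℱ μ b A)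
    (hA : A.det ≠ 0) {m : ℕ} {f : EuclideanSpace ℝ (Fin n) → EuclideanSpace ℝ (Fin m)}
    (hf : Measurable f) {c : EuclideanSpace ℝ (Fin m)} {C : Matrix (Fin m) (Fin m) ℝ}
    (hfB : IsBrownianMotionWith (fun t ω => f (B t ω)) ℱ μ c C) :
    ∃ (P : Matrix (Fin m) (Fin n) ℝ) (q : EuclideanSpace ℝ (Fin m)),
      ∀ᵐ x, f x = WithLp.toLp 2 (P *ᵥ x.ofLp) + q := by
  obtain ⟨S, hS⟩ := exists_multivariateGaussian_eq_map hB.posSemidef hA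
  refine _root_.exists_ae_eq_mulVec_add fun j => ?_
  refine exists_ae_eq_affine_of_hasIncrementMoments (b := b) (S := S) (c := c j) (V := C j j) ?_
  filter_upwards [ae_all_iff.2 fun k : ℕ => hB.ae_map_comp_increment hA hf hfB (k + 1)] with x hx k
  have hk : (0 : ℝ) ≤ (k : ℝ) + 1 := by positivity
  have h := hx k
  push_cast at h
  rw [hS b _ hk] at h
  exact hasIncrementMoments_of_map_eq hf hfB.posSemidef hk h j

/-- Almost everywhere equality of `f` with a continuous `g` passes to the paths: for fixed `t > 0`
by absolute continuity of the law of `B t`, then for all times by continuity. -/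
lemma ae_forall_comp_eq [IsProbabilityMeasure μ] (hB : IsBrownianMotionWith B ℱ μ b A)
    (hA : A.det ≠ 0) {F : Type*} [TopologicalSpace F] [T2Space F]
    {f g : EuclideanSpace ℝ (Fin n) → F} (hg : Continuous g)
    (hcont : ∀ᵐ ω ∂μ, Continuous fun t => f (B t ω)) (hfg : ∀ᵐ x, f x = g x) :
    ∀ᵐ ω ∂μ, ∀ t : ℝ≥0, f (B t ω) = g (B t ω) := by
  have hd : Dense (Set.Ioi (0 : ℝ≥0)) := by
    rw [dense_iff_closure_eq, closure_Ioi, Set.eq_univ_iff_forall]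
    exact fun t => Set.mem_Ici.2 zero_le
  obtain ⟨D, hDs, hDc, hDd⟩ := hd.exists_countable_dense_subset
  have h1 : ∀ᵐ ω ∂μ, ∀ t ∈ D, f (B t ω) = g (B t ω) := by
    refine (ae_ball_iff hDc).2 fun t ht => ?_
    have h2 := (hB.map_absolutelyContinuous_volume hA (hDs ht)).ae_le hfg
    exact ae_of_ae_map (hB.measurable t).aemeasurable h2
  filter_upwards [h1, hcont, hB.continuous_paths] with ω hω hfc hBc t
  exact congrFun (hfc.ext_on hDd (hg.comp hBc) fun s hs => hω s hs) t

/-- A non-degenerate one-dimensional Brownian motion hits any given point with positive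
probability, so almost sure properties of all the points of its paths hold everywhere. -/
lemma forall_of_ae_forall [IsProbabilityMeasure μ] (hB : IsBrownianMotionWith B ℱ μ b A)
    (hA : A.det ≠ 0) (hn : n = 1) {p : EuclideanSpace ℝ (Fin n) → Prop}
    (h : ∀ᵐ ω ∂μ, ∀ t : ℝ≥0, p (B t ω)) (x : EuclideanSpace ℝ (Fin n)) : p x := by
  subst hn
  have hlaw := hB.map_prodMk_increment (s := 1) (t := 2) one_le_two (hB.adapted 1)
  have hr : (((2 : ℝ≥0) : ℝ) - ((1 : ℝ≥0) : ℝ)) = 1 := by norm_num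
  rw [hr, one_smul, one_smul] at hlaw
  let U : Set (EuclideanSpace ℝ (Fin 1) × EuclideanSpace ℝ (Fin 1)) :=
    {q | q.1 0 < x 0 ∧ x 0 < q.1 0 + q.2 0}
  have hU : IsOpen U :=
    (isOpen_lt (f := fun q : EuclideanSpace ℝ (Fin 1) × EuclideanSpace ℝ (Fin 1) => q.1 0)
      (g := fun _ => x 0) (by fun_prop) (by fun_prop)).inter
    (isOpen_lt (f := fun _ => x 0)
      (g := fun q : EuclideanSpace ℝ (Fin 1) × EuclideanSpace ℝ (Fin 1) => q.1 0 + q.2 0)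
      (by fun_prop) (by fun_prop))
  have hUne : U.Nonempty := by
    refine ⟨(WithLp.toLp 2 fun _ => x 0 - 1, WithLp.toLp 2 fun _ => 2), ?_, ?_⟩
    all_goals simp
    linarith
  have hpos : μ.map (fun ω => (B 1 ω, B 2 ω - B 1 ω)) U ≠ 0 := by
    rw [hlaw]
    intro h0
    exact (hU.measure_pos (volume.prod volume) hUne).ne'
      (((hB.volume_absolutelyContinuous_map hA one_pos).prod
        (volume_absolutelyContinuous_multivariateGaussian hB.posSemidef hA b)) h0)
  rw [Measure.map_apply (hB.measurable_prodMk_increment 1 2)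
    hU.measurableSet] at hpos
  obtain ⟨ω, ⟨h1, h2⟩, hω, hc⟩ := ((frequently_ae_mem_iff.2 hpos).and_eventually
    (h.and hB.continuous_paths)).exists
  have hc0 : Continuous fun t => B t ω 0 := by fun_prop
  simp only [PiLp.sub_apply, add_sub_cancel] at h2
  -- The path goes from below `x` at time `1` to above `x` at time `2`.
  obtain ⟨t, -, ht⟩ := intermediate_value_Icc (one_le_two : (1 : ℝ≥0) ≤ 2) hc0.continuousOn
    ⟨h1.le, h2.le⟩
  have : B t ω = x := by
    ext i
    rw [Subsingleton.elim i 0]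
    exact ht
  exact this ▸ hω t

end IsBrownianMotionWith

theorem theorem1 {Ω : Type*} {mΩ : MeasurableSpace Ω} (μ : Measure Ω) [IsProbabilityMeasure μ]
    (ℱ : Filtration ℝ≥0 mΩ) (n m : ℕ)
    (B : ℝ≥0 → Ω → EuclideanSpace ℝ (Fin n))
    (b : EuclideanSpace ℝ (Fin n)) (A : Matrix (Fin n) (Fin n) ℝ)
    (hB : IsBrownianMotionWith B ℱ μ b A) (hA : A.det ≠ 0)
    (f : EuclideanSpace ℝ (Fin n) → EuclideanSpace ℝ (Fin m)) (hf : Measurable f)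
    (hfB : IsBrownianMotion (fun t ω => f (B t ω)) ℱ μ) :
    ∃ (P : Matrix (Fin m) (Fin n) ℝ) (q : EuclideanSpace ℝ (Fin m)),
      (∀ᵐ x ∂(volume : Measure (EuclideanSpace ℝ (Fin n))),
        f x = WithLp.toLp 2 (P *ᵥ x.ofLp) + q) ∧
      (∀ᵐ ω ∂μ, ∀ t : ℝ≥0, f (B t ω) = WithLp.toLp 2 (P *ᵥ (B t ω).ofLp) + q) ∧
      ((n ≤ 1 ∨ Continuous f) → ∀ x, f x = WithLp.toLp 2 (P *ᵥ x.ofLp) + q) := by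
  obtain ⟨c, C, hfB⟩ := hfB
  obtain ⟨P, q, hPq⟩ := hB.exists_ae_eq_mulVec_add hA hf hfB
  have hg : Continuous fun x : EuclideanSpace ℝ (Fin n) =>
      WithLp.toLp 2 (P *ᵥ x.ofLp) + q := by fun_prop
  have hpaths := hB.ae_forall_comp_eq hA hg hfB.continuous_paths hPq
  refine ⟨P, q, hPq, hpaths, ?_⟩
  rintro (hn | hfc)
  · obtain hn | hn : n = 0 ∨ n = 1 := by omega
    · subst hn
      obtain ⟨y, hy⟩ := hPq.exists
      exact fun x => Subsingleton.elim y x ▸ hy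
    · exact hB.forall_of_ae_forall hA hn hpaths
  · exact congrFun ((hfc.ae_eq_iff_eq volume hg).1 hPq)
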